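/- Let $k=\mathbb{Q}(\sqrt{-3})$ with ring of integers $\mathfrak{O}_k=\mathbb{Z}[\zeta_3]$, $\zeta_3=e^{2\pi i/3}$, and let $\mathrm{N}(\mathfrak{p})$ denote the norm of a (nonzero) prime ideal $\mathfrak{p}$ of $\mathfrak{O}_k$. For $s\in\mathbb{C}$ with $\Re(s)>\frac12$ and $y=y_1+iy_2\in\mathbb{C}$ define $\widetilde{M}_s(y)=\widetilde{M}_s(y_1,y_2)$, in Case 1 (the case of $\log L$), by \[ \widetilde{M}_{s}(y)= \exp\left(-i\Re\left(\bar{y}\log\left(1-3^{-s}\right)\right)\right)\prod_{\mathfrak{p}\nmid\langle3\rangle} \left( \frac{1}{\mathrm{N}(\mathfrak{p})+1}+\frac{1}{3}\frac{\mathrm{N}(\mathfrak{p})}{\mathrm{N}(\mathfrak{p})+1}\sum_{j=0}^{2}\exp\left(-i\Re\left(\bar{y}\log\left(1-\frac{\zeta_{3}^{j}}{\mathrm{N}(\mathfrak{p})^{s}}\right)\right)\right) \right) \] (with the principal logarithm), and, in Case 2 (the case of $L'/L$), by \[ \widetilde{M}_{s}(y)= \exp\left(-i\Re\left(\frac{\bar{y}\log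 3}{3^{s}-1}\right)\right)\prod_{\mathfrak{p}\nmid\langle3\rangle} \left( \frac{1}{\mathrm{N}(\mathfrak{p})+1}+\frac{1}{3}\frac{\mathrm{N}(\mathfrak{p})}{\mathrm{N}(\mathfrak{p})+1}\sum_{j=0}^{2}\exp\left(-i\Re\left(\frac{\bar{y}\,\zeta_{3}^{j}\log\mathrm{N}(\mathfrak{p})}{\mathrm{N}(\mathfrak{p})^{s}-\zeta_{3}^{j}}\right)\right) \right). \] Then for every $\sigma>\frac12$ there are positive constants $C_1$ and $C_2$, depending only on $\sigma$, such that the following holds for each fixed $s$ with $\Re(s)=\sigma$: both products converge unconditionally for every $y\in\mathbb{C}$, and, for all $y$ with $|y|$ sufficiently large, \[ \left|\widetilde{M}_s(y)\right|\leq\begin{cases}\exp\left(-C_1|y|^{\frac1{\sigma}}\left(\log|y|\right)^{-1}\right)& \text{in Case 1},\\[2pt] \exp\left(-C_2|y|^{\frac1{\sigma}}\left(\log|y|\right)^{\frac{1}{\sigma}-1}\right) &\text{in Case 2}.\end{cases} \] -/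

import Mathlib

open scoped NumberField

noncomputable section

namespace CubicTwists

/-- The field `k = ℚ(√-3) = ℚ(ζ₃)`. -/
abbrev k : Type := CyclotomicField 3 ℚ

/-- The complex number `ζ₃ = exp(2πi/3)`. -/
def zeta3 : ℂ := Complex.exp (2 * Real.pi * Complex.I / 3)

/-- The prime ideals `𝔭` of `𝓞 k` (nonzero, as usual) with `𝔭 ∤ ⟨3⟩`. -/
abbrev PrimeNotDvdThree : Type :=
  {p : IsDedekindDomain.HeightOneSpectrum (𝓞 k) //
    ¬ p.asIdeal ∣ Ideal.span {(3 : 𝓞 k)}}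

/-- `a_{𝔭,j}(s) = log(1 - ζ₃^j N(𝔭)^{-s})` for `N(𝔭) = N` (the case of `log L`), with the
principal logarithm. -/
def aLog (s : ℂ) (N j : ℕ) : ℂ :=
  Complex.log (1 - zeta3 ^ j * (N : ℂ) ^ (-s))

/-- `a_{𝔭,j}(s) = ζ₃^j log N(𝔭) / (N(𝔭)^s - ζ₃^j)` for `N(𝔭) = N` (the case of `L'/L`). -/
def aLogDeriv (s : ℂ) (N j : ℕ) : ℂ :=
  zeta3 ^ j * (Real.log N : ℂ) / ((N : ℂ) ^ s - zeta3 ^ j)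

/-- `exp(-i Re(ȳ a))`. -/
def phase (y a : ℂ) : ℂ :=
  Complex.exp (-Complex.I * (((starRingEnd ℂ) y * a).re : ℂ))

/-- The Euler factor `1/(N+1) + (1/3) (N/(N+1)) ∑_{j=0}^{2} exp(-i Re(ȳ a_{𝔭,j}))`, `N = N(𝔭)`. -/
def eulerFactor (a : ℕ → ℕ → ℂ) (y : ℂ) (p : PrimeNotDvdThree) : ℂ :=
  1 / ((Ideal.absNorm p.1.asIdeal : ℂ) + 1) +
    1 / 3 * ((Ideal.absNorm p.1.asIdeal : ℂ) / ((Ideal.absNorm p.1.asIdeal : ℂ) + 1)) *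
      ∑ j ∈ Finset.range 3, phase y (a (Ideal.absNorm p.1.asIdeal) j)

/-- The factor `exp(-i Re(ȳ a_{𝔭,0}))` at the prime above `3` (which has norm `3`) times the
product of the Euler factors over all prime ideals `𝔭 ∤ ⟨3⟩`. -/
def charProduct (a : ℕ → ℕ → ℂ) (y : ℂ) : ℂ :=
  phase y (a 3 0) * ∏' p : PrimeNotDvdThree, eulerFactor a y p

/-- `M̃_s(y)` in the case of `log L`. -/
def MtildeLog (s y : ℂ) : ℂ := charProduct (aLog s) y

/-- `M̃_s(y)` in the case of `L'/L`. -/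
def MtildeLogDeriv (s y : ℂ) : ℂ := charProduct (aLogDeriv s) y

end CubicTwists

end

/-!
Every Euler factor is an average of unimodular numbers, so it has norm at most `1`, and any set of
primes bounds the product. Since `a_{𝔭,j} ≈ ζ₃^j c_N` with `N = N(𝔭)`, the three arguments
`Re(ȳ a_{𝔭,j})` are far apart on the scale `|y c_N|`; when `|y c_N| ≍ 1` the average falls short
of `1` by a constant. This happens for all primes of norm `p ∈ (X, BX]` with
`X ≍ |y|^{1/σ}` for `log L` and `X ≍ (|y| log |y|)^{1/σ}` for `L'/L`. Rational primes `p ≡ 1 mod 3`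
are norms of prime ideals, and for suitable `B` there are `≫ X / log X` of them in `(X, BX]`, which
gives the exponent. The count follows from Mertens' theorem in arithmetic progressions,
`φ(q) ∑_{p ≤ x, p ≡ a} (log p) / p = log x + O(1)`, which in turn rests on `L(1, χ) ≠ 0`.
For convergence, `∑_j ζ₃^j = 0` removes the term of first order in `N^{-σ}`, and the remaining
terms are summable because `2σ > 1`.
-/

namespace CubicTwists

open Filter Asymptotics Topology
open scoped Finset ComplexConjugate
open Finset (Ioc range mem_Ioc sum_congr mul_sum sum_sub_distrib sum_le_sum)
open ArithmeticFunction (vonMangoldt vonMangoldt_nonneg)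

/-! ### Primes in arithmetic progressions -/

lemma norm_sum_Ioc_smul_le_of_antitoneOn {E : Type*} [NormedAddCommGroup E] [NormedSpace ℝ E]
    {z : ℕ → E} {f : ℕ → ℝ} {K : ℝ} {a b : ℕ} (hz : ∀ n, ‖∑ i ∈ range n, z i‖ ≤ K)
    (hf : AntitoneOn f (Set.Ici a)) (hf₀ : ∀ n, a ≤ n → 0 ≤ f n) (hab : a ≤ b) :
    ‖∑ n ∈ Ioc a b, f n • z n‖ ≤ 2 * K * f a := by
  have hfZ (n : ℕ) {c : ℝ} (hc : 0 ≤ c) : ‖c • ∑ i ∈ range n, z i‖ ≤ K * c := by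
    rw [norm_smul, Real.norm_of_nonneg hc, mul_comm]
    exact mul_le_mul_of_nonneg_right (hz n) hc
  have hsharp : ‖∑ n ∈ Ioc a b, f n • z n - f b • ∑ i ∈ range (b + 1), z i‖ ≤
      K * (2 * f a - f b) := by
    induction b, hab using Nat.le_induction with
    | base => simpa [two_mul] using hfZ (a + 1) (hf₀ a le_rfl)
    | succ b hab ih =>
      have hstep : 0 ≤ f b - f (b + 1) :=
        sub_nonneg.2 (hf hab (hab.trans b.le_succ) b.le_succ)
      calc ‖∑ n ∈ Ioc a (b + 1), f n • z n - f (b + 1) • ∑ i ∈ range (b + 2), z i‖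
          = ‖(∑ n ∈ Ioc a b, f n • z n - f b • ∑ i ∈ range (b + 1), z i) +
              (f b - f (b + 1)) • ∑ i ∈ range (b + 1), z i‖ := by
            rw [Finset.sum_Ioc_succ_top hab, Finset.sum_range_succ _ (b + 1)]
            congr 1
            module
        _ ≤ K * (2 * f a - f b) + K * (f b - f (b + 1)) :=
            (norm_add_le _ _).trans (add_le_add ih (hfZ _ hstep))
        _ = K * (2 * f a - f (b + 1)) := by ring
  calc ‖∑ n ∈ Ioc a b, f n • z n‖
      ≤ ‖∑ n ∈ Ioc a b, f n • z n - f b • ∑ i ∈ range (b + 1), z i‖ +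
          ‖f b • ∑ i ∈ range (b + 1), z i‖ :=
        norm_le_norm_sub_add _ _
    _ ≤ K * (2 * f a - f b) + K * f b := add_le_add hsharp (hfZ _ (hf₀ b hab))
    _ = 2 * K * f a := by ring

lemma sum_log_div_smul_dirichletCharacter {q : ℕ} (χ : DirichletCharacter ℂ q) (N : ℕ) :
    ∑ n ∈ Ioc 0 N, (Real.log n / n) • χ n =
      ∑ d ∈ Ioc 0 N, (vonMangoldt d / d) • χ d * ∑ m ∈ Ioc 0 (N / d), (m : ℝ)⁻¹ • χ m := by
  let f : ArithmeticFunction ℂ := ⟨fun n => (vonMangoldt n / n) • χ n, by simp⟩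
  let g : ArithmeticFunction ℂ := ⟨fun n => (n : ℝ)⁻¹ • χ n, by simp⟩
  refine Eq.trans (sum_congr rfl fun n _ => ?_)
    (ArithmeticFunction.sum_Ioc_mul_eq_sum_sum f g N)
  rw [ArithmeticFunction.mul_apply, Nat.sum_divisorsAntidiagonal fun d m => f d * g m,
    ← ArithmeticFunction.vonMangoldt_sum, Finset.sum_div, Finset.sum_smul]
  refine sum_congr rfl fun d hd => ?_
  obtain ⟨m, rfl⟩ := Nat.dvd_of_mem_divisors hd
  have hd₀ : 0 < d := Nat.pos_of_mem_divisors hd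
  change _ = (vonMangoldt d / d) • χ d * ((d * m / d : ℕ) : ℝ)⁻¹ • χ (d * m / d : ℕ)
  rw [Nat.mul_div_cancel_left m hd₀, smul_mul_smul_comm, ← map_mul]
  push_cast
  rw [div_mul_eq_div_div, div_eq_mul_inv _ (m : ℝ)]

section DirichletCharacter

variable {q : ℕ} [NeZero q] {χ : DirichletCharacter ℂ q}

lemma norm_sum_range_dirichletCharacter_le (hχ : χ ≠ 1) (n : ℕ) :
    ‖∑ i ∈ range n, χ i‖ ≤ q := by
  have hperiod : Function.Periodic (fun n : ℕ => ∑ i ∈ range n, χ i) q := fun n => by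
    have hcomplete : ∑ i ∈ range q, χ (n + i : ℕ) = 0 :=
      calc ∑ i ∈ range q, χ (n + i : ℕ) = ∑ x : ZMod q, χ (n + x) :=
            Finset.sum_nbij' (fun i => (i : ZMod q)) ZMod.val (by simp)
              (fun x _ => Finset.mem_range.2 x.val_lt)
              (fun i hi => ZMod.val_cast_of_lt (Finset.mem_range.1 hi)) (by simp) (by simp)
        _ = ∑ x : ZMod q, χ x := Equiv.sum_comp (Equiv.addLeft (n : ZMod q)) χ
        _ = 0 := MulChar.sum_eq_zero_of_ne_one hχ
    simp only [Finset.sum_range_add, hcomplete, add_zero]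
  have hn : n % q < q := Nat.mod_lt n (NeZero.pos q)
  calc ‖∑ i ∈ range n, χ i‖ = ‖∑ i ∈ range (n % q), χ i‖ :=
        congrArg norm (hperiod.map_mod_nat n).symm
    _ ≤ ∑ _i ∈ range (n % q), (1 : ℝ) := norm_sum_le_of_le _ fun i _ => χ.norm_le_one i
    _ ≤ q := by simpa using hn.le

lemma hasSum_rpow_neg_smul_dirichletCharacter {s : ℝ} (hs : 1 < s) :
    HasSum (fun n : ℕ => (n : ℝ) ^ (-s) • χ n) (χ.LFunction s) := by
  have hs' : 1 < (s : ℂ).re := by simpa using hs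
  rw [χ.LFunction_eq_LSeries hs']
  refine (χ.LSeriesSummable_of_one_lt_re hs').LSeriesHasSum.congr_fun fun n => ?_
  rw [LSeries.term_of_ne_zero' (by simpa using (one_pos.trans hs).ne'),
    Real.rpow_neg n.cast_nonneg, Complex.real_smul, Complex.ofReal_inv,
    Complex.ofReal_cpow n.cast_nonneg, Complex.ofReal_natCast, div_eq_inv_mul]

lemma norm_LFunction_sub_sum_le (hχ : χ ≠ 1) {s : ℝ} (hs : 1 < s) {N : ℕ} (hN : 0 < N) :
    ‖χ.LFunction s - ∑ n ∈ Ioc 0 N, (n : ℝ) ^ (-s) • χ n‖ ≤ 2 * q * (N : ℝ) ^ (-s) := by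
  have hlim : Tendsto (fun M : ℕ => ∑ n ∈ Ioc 0 M, (n : ℝ) ^ (-s) • χ n) atTop
      (𝓝 (χ.LFunction s)) := by
    refine ((hasSum_rpow_neg_smul_dirichletCharacter hs).tendsto_sum_nat.comp
      (tendsto_add_atTop_nat 1)).congr fun M => ?_
    rw [Function.comp_apply, Nat.range_succ_eq_Icc_zero, ← Finset.sum_Ioc_add_eq_sum_Icc M.zero_le,
      Nat.cast_zero, Real.zero_rpow (by linarith), zero_smul, add_zero]
  refine le_of_tendsto (hlim.sub_const _).norm ?_
  filter_upwards [eventually_ge_atTop N] with M hM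
  rw [← Finset.sum_Ioc_consecutive _ N.zero_le hM, add_sub_cancel_left]
  refine norm_sum_Ioc_smul_le_of_antitoneOn (f := fun n : ℕ => (n : ℝ) ^ (-s))
    (norm_sum_range_dirichletCharacter_le hχ) (fun m hm n _ hmn => ?_)
    (fun n _ => by positivity) hM
  exact Real.rpow_le_rpow_of_nonpos (by exact_mod_cast hN.trans_le hm) (by exact_mod_cast hmn)
    (by linarith)

lemma norm_LFunction_one_sub_sum_le (hχ : χ ≠ 1) {N : ℕ} (hN : 0 < N) :
    ‖χ.LFunction 1 - ∑ n ∈ Ioc 0 N, (n : ℝ)⁻¹ • χ n‖ ≤ 2 * q / N := by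
  have hsum : Continuous fun s : ℝ => ∑ n ∈ Ioc 0 N, (n : ℝ) ^ (-s) • χ n :=
    continuous_finsetSum _ fun n hn => by
      have hn₀ : (n : ℝ) ≠ 0 := by exact_mod_cast (mem_Ioc.1 hn).1.ne'
      exact (continuous_const.rpow continuous_neg fun _ => .inl hn₀).smul continuous_const
  have hbound : Continuous fun s : ℝ => 2 * q * (N : ℝ) ^ (-s) :=
    continuous_const.mul (continuous_const.rpow continuous_neg fun _ => .inl (by positivity))
  have hL : Continuous fun s : ℝ => χ.LFunction s :=
    (DirichletCharacter.differentiable_LFunction hχ).continuous.comp Complex.continuous_ofReal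
  have hlim {g : ℝ → ℝ} (hg : Continuous g) : Tendsto g (𝓝[>] 1) (𝓝 (g 1)) :=
    hg.continuousWithinAt
  simpa [Real.rpow_neg_one, div_eq_mul_inv] using
    le_of_tendsto_of_tendsto (hlim (hL.sub hsum).norm) (hlim hbound)
      (eventually_mem_nhdsWithin.mono fun s hs => norm_LFunction_sub_sum_le hχ hs hN)

lemma isBigO_sum_log_div_smul_dirichletCharacter (hχ : χ ≠ 1) :
    (fun N : ℕ => ∑ n ∈ Ioc 0 N, (Real.log n / n) • χ n) =O[atTop] fun _ => (1 : ℝ) := by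
  refine IsBigO.of_bound (‖∑ n ∈ Ioc (0 : ℕ) 3, (Real.log n / n) • χ n‖ +
    2 * q * (Real.log (3 : ℕ) / (3 : ℕ))) ?_
  filter_upwards [eventually_ge_atTop 3] with N hN
  have hexp {n : ℕ} (hn : 3 ≤ n) : Real.exp 1 ≤ n :=
    Real.exp_one_lt_three.le.trans (by exact_mod_cast hn)
  rw [norm_one, mul_one, ← Finset.sum_Ioc_consecutive _ (Nat.zero_le 3) hN]
  refine (norm_add_le _ _).trans (add_le_add_right ?_ _)
  exact norm_sum_Ioc_smul_le_of_antitoneOn (f := fun n : ℕ => Real.log n / n)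
    (norm_sum_range_dirichletCharacter_le hχ)
    (fun m hm n hn hmn => Real.log_div_self_antitoneOn (hexp hm) (hexp hn) (by exact_mod_cast hmn))
    (fun n _ => div_nonneg (Real.log_natCast_nonneg n) n.cast_nonneg) hN

lemma norm_LFunction_one_mul_sum_sub_le (hχ : χ ≠ 1) {N : ℕ} (hN : 0 < N) :
    ‖χ.LFunction 1 * ∑ n ∈ Ioc 0 N, (vonMangoldt n / n) • χ n -
      ∑ n ∈ Ioc 0 N, (Real.log n / n) • χ n‖ ≤ 4 * q * (Real.log 4 + 4) := by
  have hN' : (0 : ℝ) < N := by exact_mod_cast hN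
  have hterm (d : ℕ) (hd : d ∈ Ioc 0 N) :
      ‖(vonMangoldt d / d) • χ d *
        (χ.LFunction 1 - ∑ m ∈ Ioc 0 (N / d), (m : ℝ)⁻¹ • χ m)‖ ≤ 4 * q / N * vonMangoldt d := by
    obtain ⟨hd₀, hdN⟩ := mem_Ioc.1 hd
    have hd' : (0 : ℝ) < d := by exact_mod_cast hd₀
    have hquot : 0 < N / d := Nat.div_pos hdN hd₀
    have hfloor : (N : ℝ) ≤ 2 * d * (N / d : ℕ) := by
      have := Nat.lt_mul_div_succ N hd₀
      exact_mod_cast (by nlinarith : N ≤ 2 * d * (N / d))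
    calc _ ≤ (vonMangoldt d / d * 1) * (2 * q / (N / d : ℕ)) := by
          rw [norm_mul, norm_smul, Real.norm_of_nonneg (div_nonneg vonMangoldt_nonneg hd'.le)]
          have := vonMangoldt_nonneg (n := d)
          gcongr
          · exact χ.norm_le_one d
          · exact norm_LFunction_one_sub_sum_le hχ hquot
      _ ≤ (vonMangoldt d / d * 1) * (2 * q * (2 * d / N)) := by
          have := vonMangoldt_nonneg (n := d)
          rw [div_eq_mul_inv (2 * q : ℝ)]
          gcongr
          rwa [inv_le_comm₀ (by exact_mod_cast hquot) (by positivity), inv_div,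
            div_le_iff₀' (by positivity)]
      _ = 4 * q / N * vonMangoldt d := by field_simp; ring
  calc _ = ‖∑ d ∈ Ioc 0 N, (vonMangoldt d / d) • χ d *
          (χ.LFunction 1 - ∑ m ∈ Ioc 0 (N / d), (m : ℝ)⁻¹ • χ m)‖ := by
        simp only [mul_sub, sum_sub_distrib, sum_log_div_smul_dirichletCharacter, mul_comm,
          mul_sum]
    _ ≤ ∑ d ∈ Ioc 0 N, 4 * q / N * vonMangoldt d := norm_sum_le_of_le _ hterm
    _ = 4 * q / N * Chebyshev.psi N := by simp [Chebyshev.psi, mul_sum]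
    _ ≤ 4 * q / N * ((Real.log 4 + 4) * N) := by
        gcongr
        exact Chebyshev.psi_le_const_mul_self hN'.le
    _ = 4 * q * (Real.log 4 + 4) := by field_simp

lemma isBigO_sum_vonMangoldt_div_smul_dirichletCharacter (hχ : χ ≠ 1) :
    (fun N : ℕ => ∑ n ∈ Ioc 0 N, (vonMangoldt n / n) • χ n) =O[atTop] fun _ => (1 : ℝ) := by
  have hdiff : (fun N : ℕ => χ.LFunction 1 * ∑ n ∈ Ioc 0 N, (vonMangoldt n / n) • χ n -
      ∑ n ∈ Ioc 0 N, (Real.log n / n) • χ n) =O[atTop] fun _ => (1 : ℝ) := by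
    refine IsBigO.of_bound (4 * q * (Real.log 4 + 4)) ?_
    filter_upwards [eventually_gt_atTop 0] with N hN
    simpa using norm_LFunction_one_mul_sum_sub_le hχ hN
  have hprod := hdiff.add (isBigO_sum_log_div_smul_dirichletCharacter hχ)
  simp only [sub_add_cancel] at hprod
  exact (isBigO_const_mul_left_iff (DirichletCharacter.LFunction_apply_one_ne_zero hχ)).1 hprod

end DirichletCharacter

lemma log_factorial_eq_sum_vonMangoldt (N : ℕ) :
    Real.log N.factorial = ∑ n ∈ Ioc 0 N, vonMangoldt n * ((N / n : ℕ) : ℝ) := by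
  rw [← ArithmeticFunction.sum_Ioc_mul_zeta_eq_sum, ArithmeticFunction.vonMangoldt_mul_zeta,
    ← Finset.prod_Ico_id_eq_factorial, Nat.cast_prod, Real.log_prod fun n hn => by
      have := (Finset.mem_Ico.1 hn).1; positivity]
  exact sum_congr (by ext; simp; omega) fun n _ => (ArithmeticFunction.log_apply).symm

lemma isBigO_sum_vonMangoldt_div_sub_log :
    (fun N : ℕ => ∑ n ∈ Ioc 0 N, vonMangoldt n / n - Real.log N) =O[atTop] fun _ => (1 : ℝ) := by
  refine IsBigO.of_bound (Real.log 4 + 4) ?_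
  filter_upwards [eventually_gt_atTop 0] with N hN
  have hN' : (0 : ℝ) < N := by exact_mod_cast hN
  have hψ : Chebyshev.psi N ≤ (Real.log 4 + 4) * N := Chebyshev.psi_le_const_mul_self hN'.le
  have hlog4 : 0 ≤ Real.log 4 := Real.log_nonneg (by norm_num)
  have hstirling : N * Real.log N - N ≤ Real.log N.factorial := by
    have := Stirling.le_log_factorial_stirling hN.ne'
    have := Real.log_natCast_nonneg N
    have := Real.log_nonneg (show 1 ≤ 2 * Real.pi by linarith [Real.pi_gt_three])
    linarith
  have hfactorial : Real.log N.factorial ≤ N * Real.log N := by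
    rw [← Real.log_pow]
    exact Real.log_le_log (by positivity) (by exact_mod_cast Nat.factorial_le_pow N)
  have hupper : Real.log N.factorial ≤ N * ∑ n ∈ Ioc 0 N, vonMangoldt n / n := by
    rw [log_factorial_eq_sum_vonMangoldt, mul_sum]
    refine sum_le_sum fun n _ => ?_
    rw [mul_div_left_comm]
    exact mul_le_mul_of_nonneg_left Nat.cast_div_le vonMangoldt_nonneg
  have hlower : N * ∑ n ∈ Ioc 0 N, vonMangoldt n / n - Chebyshev.psi N ≤
      Real.log N.factorial := by
    rw [log_factorial_eq_sum_vonMangoldt, Chebyshev.psi, Nat.floor_natCast, mul_sum,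
      ← sum_sub_distrib]
    refine sum_le_sum fun n _ => ?_
    have hfloor : (N : ℝ) / n ≤ (N / n : ℕ) + 1 := by
      rw [← Nat.floor_div_eq_div (K := ℝ)]
      exact (Nat.lt_floor_add_one _).le
    have := mul_le_mul_of_nonneg_left hfloor (vonMangoldt_nonneg (n := n))
    linear_combination this
  rw [norm_one, mul_one, Real.norm_eq_abs, abs_le]
  constructor <;> refine le_of_mul_le_mul_left ?_ hN' <;> nlinarith

lemma isBigO_sum_Ioc_of_summable {f : ℕ → ℝ} (hf : Summable f) :
    (fun N : ℕ => ∑ n ∈ Ioc 0 N, f n) =O[atTop] fun _ => (1 : ℝ) :=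
  IsBigO.of_bound (∑' n, ‖f n‖) <| .of_forall fun N => by
    rw [norm_one, mul_one]
    exact (norm_sum_le _ _).trans (hf.norm.sum_le_tsum _ fun n _ => norm_nonneg _)

section ResidueClass

variable {q : ℕ} [NeZero q]

lemma summable_vonMangoldt_div_of_not_isUnit :
    Summable fun n : ℕ => if IsUnit (n : ZMod q) then 0 else vonMangoldt n / n := by
  have hnonprime := vonMangoldt.summable_residueClass_non_primes_div (0 : ZMod 1)
  have hprime : Summable fun n : ℕ => if n ∈ q.primeFactors then vonMangoldt n / n else 0 :=
    summable_of_ne_finset_zero (s := q.primeFactors) fun n hn => if_neg hn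
  have hnonneg (n : ℕ) : 0 ≤ vonMangoldt n / n := div_nonneg vonMangoldt_nonneg n.cast_nonneg
  have hzero (n : ℕ) : (n : ZMod 1) = 0 := Subsingleton.elim _ _
  refine (hnonprime.add hprime).of_nonneg_of_le (fun n => ?_) fun n => ?_
  · split_ifs
    exacts [le_rfl, hnonneg n]
  · by_cases hn : n.Prime
    · simp only [ZMod.isUnit_prime_iff_not_dvd hn, Nat.mem_primeFactors, hn]
      by_cases hq : n ∣ q <;> simp [hq, NeZero.ne q]
    · have hmem : n ∉ q.primeFactors := fun h => hn (Nat.prime_of_mem_primeFactors h)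
      simp only [hn, hmem, vonMangoldt.residueClass, Set.indicator, Set.mem_ofPred_eq, hzero]
      split_ifs <;> simp [hnonneg n]

lemma isBigO_sum_vonMangoldt_div_smul_sub (χ : DirichletCharacter ℂ q) :
    (fun N : ℕ => ∑ n ∈ Ioc 0 N, (vonMangoldt n / n) • χ n - if χ = 1 then (Real.log N : ℂ) else 0)
      =O[atTop] fun _ => (1 : ℝ) := by
  split_ifs with hχ
  · subst hχ
    have hunit (n : ℕ) : (vonMangoldt n / n) • (1 : DirichletCharacter ℂ q) n =
        ((vonMangoldt n / n - if IsUnit (n : ZMod q) then 0 else vonMangoldt n / n : ℝ) : ℂ) := by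
      by_cases hn : IsUnit (n : ZMod q) <;> simp [hn, MulChar.one_apply, MulChar.map_nonunit]
    have hreal := isBigO_sum_vonMangoldt_div_sub_log.sub
      (isBigO_sum_Ioc_of_summable (summable_vonMangoldt_div_of_not_isUnit (q := q)))
    refine (Complex.isBigO_ofReal_left.2 hreal).congr_left fun N => ?_
    simp only [hunit, ← Complex.ofReal_sum, ← Complex.ofReal_sub, sum_sub_distrib]
    congr 1
    ring
  · simpa using isBigO_sum_vonMangoldt_div_smul_dirichletCharacter hχ

variable {a : ZMod q}

lemma isBigO_totient_mul_sum_residueClass_div_sub_log (ha : IsUnit a) :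
    (fun N : ℕ => q.totient * ∑ n ∈ Ioc 0 N, vonMangoldt.residueClass a n / n - Real.log N)
      =O[atTop] fun _ => (1 : ℝ) := by
  have hq : (q.totient : ℂ) ≠ 0 := by exact_mod_cast (Nat.totient_pos.2 (NeZero.pos q)).ne'
  have horth (n : ℕ) : q.totient * ((vonMangoldt.residueClass a n / n : ℝ) : ℂ) =
      ∑ χ : DirichletCharacter ℂ q, χ a⁻¹ * ((vonMangoldt n / n) • χ n) := by
    rw [Complex.ofReal_div, vonMangoldt.residueClass_apply ha, mul_div_assoc',
      mul_inv_cancel_left₀ hq, Finset.sum_div]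
    refine sum_congr rfl fun χ _ => ?_
    rw [Complex.real_smul]
    push_cast
    ring
  have hsum := IsBigO.sum (s := Finset.univ) fun (χ : DirichletCharacter ℂ q) _ =>
    (isBigO_sum_vonMangoldt_div_smul_sub χ).const_mul_left (χ a⁻¹)
  refine Complex.isBigO_ofReal_left.1 (hsum.congr_left fun N => ?_)
  have hone : (1 : DirichletCharacter ℂ q) a⁻¹ = 1 :=
    MulChar.one_apply (IsUnit.of_mul_eq_one a (ZMod.inv_mul_of_unit a ha))
  simp only [Finset.sum_apply, mul_sub, mul_ite, mul_zero, sum_sub_distrib, Finset.sum_ite_eq',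
    Finset.mem_univ, if_true, hone, one_mul, mul_sum]
  rw [Finset.sum_comm, Complex.ofReal_sub, Complex.ofReal_sum]
  refine congrArg (· - _) (sum_congr rfl fun n _ => ?_)
  rw [← horth, Complex.ofReal_mul, Complex.ofReal_natCast]

lemma isBigO_totient_mul_sum_prime_log_div_sub_log (ha : IsUnit a) :
    (fun N : ℕ => q.totient * ∑ p ∈ Ioc 0 N with p.Prime ∧ ((p : ℕ) : ZMod q) = a, Real.log p / p -
      Real.log N) =O[atTop] fun _ => (1 : ℝ) := by
  have hnonprime := isBigO_sum_Ioc_of_summable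
    (vonMangoldt.summable_residueClass_non_primes_div a)
  refine ((isBigO_totient_mul_sum_residueClass_div_sub_log ha).sub
    (hnonprime.const_mul_left (q.totient : ℝ))).congr_left fun N => ?_
  have hprime (p : ℕ) : (if p.Prime ∧ (p : ZMod q) = a then Real.log p / p else 0) =
      vonMangoldt.residueClass a p / p -
        (if p.Prime then 0 else vonMangoldt.residueClass a p) / p := by
    by_cases hp : p.Prime <;> by_cases hpa : (p : ZMod q) = a <;>
      simp [hp, hpa, vonMangoldt.residueClass, ArithmeticFunction.vonMangoldt_apply_prime]
  simp only [Finset.sum_filter, hprime, sum_sub_distrib]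
  ring

lemma exists_one_le_sum_prime_log_div (ha : IsUnit a) :
    ∃ B : ℝ, 1 < B ∧ ∀ᶠ X : ℝ in atTop,
      1 ≤ ∑ p ∈ Ioc ⌊X⌋₊ ⌊B * X⌋₊ with p.Prime ∧ ((p : ℕ) : ZMod q) = a, Real.log p / p := by
  obtain ⟨C, hC₀, hC⟩ := (isBigO_totient_mul_sum_prime_log_div_sub_log ha).exists_pos
  have hq : (0 : ℝ) < q.totient := by exact_mod_cast Nat.totient_pos.2 (NeZero.pos q)
  have hexp : 1 < Real.exp (2 * C + q.totient) := Real.one_lt_exp_iff.2 (by linarith)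
  set B : ℝ := 2 * Real.exp (2 * C + q.totient) with hB
  have hB₁ : 1 < B := by linarith
  have hfloor : Tendsto (fun X : ℝ => ⌊B * X⌋₊) atTop atTop :=
    tendsto_nat_floor_atTop.comp (tendsto_id.const_mul_atTop (by linarith))
  refine ⟨B, hB₁, ?_⟩
  filter_upwards [tendsto_nat_floor_atTop.eventually hC.bound, hfloor.eventually hC.bound,
    eventually_ge_atTop 1] with X hX hBX hX₁
  have hX₀ : 0 < X := by linarith
  have hle : ⌊X⌋₊ ≤ ⌊B * X⌋₊ := Nat.floor_mono (le_mul_of_one_le_left hX₀.le hB₁.le)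
  have hlogX : Real.log ⌊X⌋₊ ≤ Real.log X :=
    Real.log_le_log (by exact_mod_cast Nat.floor_pos.2 hX₁) (Nat.floor_le hX₀.le)
  have hlogBX : 2 * C + q.totient + Real.log X ≤ Real.log ⌊B * X⌋₊ := by
    rw [← Real.log_exp (2 * C + q.totient), ← Real.log_mul (Real.exp_pos _).ne' hX₀.ne']
    refine Real.log_le_log (by positivity) ?_
    have hone : 1 ≤ Real.exp (2 * C + q.totient) * X := by nlinarith
    have hBX' : B * X = 2 * (Real.exp (2 * C + q.totient) * X) := by rw [hB, mul_assoc]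
    linarith [Nat.lt_floor_add_one (B * X), hBX', hone]
  rw [norm_one, mul_one, Real.norm_eq_abs] at hX hBX
  simp only [Finset.sum_filter] at hX hBX ⊢
  rw [← Finset.sum_Ioc_consecutive _ (Nat.zero_le _) hle] at hBX
  refine le_of_mul_le_mul_left ?_ hq
  linarith [(abs_le.1 hX).2, (abs_le.1 hBX).1]

lemma exists_le_log_mul_card_primes (ha : IsUnit a) :
    ∃ B : ℝ, 1 < B ∧ ∀ᶠ X : ℝ in atTop, X ≤ Real.log (B * X) *
      (#{p ∈ Ioc ⌊X⌋₊ ⌊B * X⌋₊ | p.Prime ∧ ((p : ℕ) : ZMod q) = a} : ℝ) := by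
  obtain ⟨B, hB₁, hB⟩ := exists_one_le_sum_prime_log_div ha
  refine ⟨B, hB₁, ?_⟩
  filter_upwards [hB, eventually_ge_atTop 1] with X hX hX₁
  have hX₀ : 0 < X := by linarith
  have hBX : 1 ≤ B * X := by nlinarith
  have hterm (p : ℕ) (hp : p ∈ Ioc ⌊X⌋₊ ⌊B * X⌋₊) : Real.log p / p ≤ Real.log (B * X) / X := by
    have hXp : X < p := (Nat.floor_lt hX₀.le).1 (mem_Ioc.1 hp).1
    have hpB : (p : ℝ) ≤ B * X := (Nat.le_floor_iff (by linarith)).1 (mem_Ioc.1 hp).2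
    exact div_le_div₀ (Real.log_nonneg hBX) (Real.log_le_log (by linarith) hpB) hX₀ hXp.le
  have hsum := hX.trans (Finset.sum_le_card_nsmul _ _ _ fun p hp =>
    hterm p (Finset.mem_filter.1 hp).1)
  rwa [nsmul_eq_mul, mul_div_assoc', one_le_div hX₀, mul_comm] at hsum

end ResidueClass

/-! ### Prime ideals of number fields -/

lemma isBigO_sum_ncard_fiber {ι : Type*} {g : ι → ℕ} (hg : ∀ n, {i | g i ≤ n}.Finite)
    (hcard : (fun n : ℕ => ({i | g i ≤ n}.ncard : ℝ)) =O[atTop] fun n => (n : ℝ)) :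
    (fun n : ℕ => ∑ m ∈ Finset.Icc 1 n, ({i | g i = m}.ncard : ℝ)) =O[atTop] fun n => (n : ℝ) := by
  classical
  refine (isBigO_of_le _ fun n => ?_).trans hcard
  have hfiber (m : ℕ) (hm : m ∈ Finset.Icc 1 n) :
      {i | g i = m}.ncard = #{i ∈ (hg n).toFinset | g i = m} := by
    rw [← Set.ncard_coe_finset]
    congr 1
    ext i
    simp only [Set.mem_ofPred_eq, Finset.coe_filter, Set.Finite.mem_toFinset]
    exact ⟨fun hi => ⟨hi.trans_le (Finset.mem_Icc.1 hm).2, hi⟩, And.right⟩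
  rw [Real.norm_of_nonneg (by positivity), Real.norm_of_nonneg (by positivity),
    Set.ncard_eq_toFinset_card _ (hg n), ← Nat.cast_sum, sum_congr rfl hfiber,
    Finset.sum_card_fiberwise_eq_card_filter]
  exact_mod_cast Finset.card_filter_le _ _

lemma summable_natCast_rpow_neg_of_isBigO_ncard {ι : Type*} {g : ι → ℕ}
    (hg : ∀ n, {i | g i ≤ n}.Finite)
    (hcard : (fun n : ℕ => ({i | g i ≤ n}.ncard : ℝ)) =O[atTop] fun n => (n : ℝ))
    {t : ℝ} (ht : 1 < t) : Summable fun i => (g i : ℝ) ^ (-t) := by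
  have hL := LSeriesSummable_of_sum_norm_bigO_and_nonneg (r := 1) (s := t)
    (by simpa using isBigO_sum_ncard_fiber hg hcard) (fun _ => Nat.cast_nonneg _) zero_le_one
    (by simpa using ht)
  have hfinite (n : ℕ) : Finite {i // g i = n} := ((hg n).subset fun i hi => le_of_eq hi).to_subtype
  rw [← (Equiv.sigmaFiberEquiv g).summable_iff,
    summable_sigma_of_nonneg fun _ => by simp only [Function.comp_apply]; positivity]
  refine ⟨fun n => Summable.of_finite, hL.norm.congr fun n => ?_⟩
  have := Fintype.ofFinite {i // g i = n}
  have hconst (i : {i // g i = n}) : (g (Equiv.sigmaFiberEquiv g ⟨n, i⟩) : ℝ) ^ (-t) =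
      (n : ℝ) ^ (-t) := congrArg (fun m : ℕ => (m : ℝ) ^ (-t)) i.2
  have hcardf : Finset.card (Finset.univ : Finset {i // g i = n}) = {i | g i = n}.ncard := by
    rw [Finset.card_univ, ← Nat.card_eq_fintype_card]
    rfl
  simp only [Function.comp_apply, hconst, tsum_fintype, Finset.sum_const, hcardf, nsmul_eq_mul]
  rcases eq_or_ne n 0 with rfl | hn
  · simp [Real.zero_rpow (by linarith : -t ≠ 0)]
  · simp [hn, Real.rpow_neg, div_eq_mul_inv]

lemma summable_absNorm_rpow_neg {K : Type*} [Field K] [NumberField K] {t : ℝ} (ht : 1 < t) :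
    Summable fun I : Ideal (𝓞 K) => (Ideal.absNorm I : ℝ) ^ (-t) := by
  refine summable_natCast_rpow_neg_of_isBigO_ncard Ideal.finite_setOfPred_absNorm_le ?_ ht
  have hlim := ((NumberField.Ideal.tendsto_norm_le_div_atTop K).comp
    tendsto_natCast_atTop_atTop).isBigO_one ℝ
  refine (hlim.mul (isBigO_refl (fun n : ℕ => (n : ℝ)) atTop)).congr' ?_ (by simp)
  filter_upwards [eventually_ne_atTop 0] with n hn
  have hn' : (n : ℝ) ≠ 0 := by exact_mod_cast hn
  simp only [Function.comp_apply, Nat.cast_le, div_mul_cancel₀ _ hn']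
  rfl

lemma two_le_absNorm {K : Type*} [Field K] [NumberField K]
    (P : IsDedekindDomain.HeightOneSpectrum (𝓞 K)) : 2 ≤ Ideal.absNorm P.asIdeal := by
  have h₀ : Ideal.absNorm P.asIdeal ≠ 0 := Ideal.absNorm_eq_zero_iff.not.2 P.ne_bot
  have h₁ : Ideal.absNorm P.asIdeal ≠ 1 := Ideal.absNorm_eq_one_iff.not.2 P.isPrime.ne_top
  omega

lemma summable_log_rpow_mul_rpow_neg {ι : Type*} {g : ι → ℕ}
    (hg : ∀ n, {i | g i ≤ n}.Finite)
    (hsum : ∀ t : ℝ, 1 < t → Summable fun i => (g i : ℝ) ^ (-t)) (r : ℝ) {t : ℝ} (ht : 1 < t) :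
    Summable fun i => Real.log (g i) ^ r * (g i : ℝ) ^ (-t) := by
  have hg_tendsto : Tendsto (fun i => (g i : ℝ)) cofinite atTop := by
    refine tendsto_natCast_atTop_atTop.comp (tendsto_atTop.2 fun n => ?_)
    exact (hg n).subset fun i hi => (not_le (a := n) (b := g i).1 hi).le
  have hlog := (isLittleO_log_rpow_rpow_atTop r (s := (t - 1) / 2) (by linarith)).isBigO
  have hpow : (fun x : ℝ => Real.log x ^ r * x ^ (-t)) =O[atTop] fun x => x ^ (-((1 + t) / 2)) := by
    refine (hlog.mul (isBigO_refl (fun x : ℝ => x ^ (-t)) atTop)).congr' .rfl ?_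
    filter_upwards [eventually_gt_atTop 0] with x hx
    rw [← Real.rpow_add hx]
    ring_nf
  exact summable_of_isBigO (hsum _ (by linarith)) (hpow.comp_tendsto hg_tendsto)

lemma summable_log_absNorm_rpow_mul_rpow_neg {K : Type*} [Field K] [NumberField K] (r : ℝ) {t : ℝ}
    (ht : 1 < t) : Summable fun I : Ideal (𝓞 K) =>
      Real.log (Ideal.absNorm I) ^ r * (Ideal.absNorm I : ℝ) ^ (-t) :=
  summable_log_rpow_mul_rpow_neg Ideal.finite_setOfPred_absNorm_le
    (fun _ => summable_absNorm_rpow_neg) r ht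

lemma exists_isPrime_absNorm_eq {m : ℕ} [NeZero m] (K : Type*) [Field K] [NumberField K]
    [IsCyclotomicExtension {m} ℚ K] {p : ℕ} (hp : p.Prime) (hpm : (p : ZMod m) = 1) :
    ∃ P : Ideal (𝓞 K), P.IsPrime ∧ Ideal.absNorm P = p := by
  have : Fact p.Prime := ⟨hp⟩
  have : (Ideal.span {(p : ℤ)}).IsMaximal := Int.ideal_span_isMaximal_of_prime p
  obtain ⟨⟨P, hP, _⟩⟩ := (Ideal.span {(p : ℤ)}).nonempty_primesOver (S := 𝓞 K)
  have hndvd : ¬ p ∣ m := (ZMod.isUnit_prime_iff_not_dvd hp).1 (hpm ▸ isUnit_one)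
  have hdeg : P.inertiaDeg ℤ = 1 := by
    rw [IsCyclotomicExtension.Rat.inertiaDeg_eq_of_not_dvd p K P hndvd, hpm, orderOf_one]
  refine ⟨P, hP, ?_⟩
  rw [← Ideal.absNorm_pow_inertiaDeg (Ideal.span {(p : ℤ)}) P, hdeg, pow_one]
  simp

lemma natCast_notMem_of_coprime_absNorm {R : Type*} [CommRing R] [IsDedekindDomain R]
    [Module.Free ℤ R] {P : Ideal R} (hP : P ≠ ⊤) {m : ℕ} (hm : m.Coprime (Ideal.absNorm P)) :
    (m : R) ∉ P := fun hmP =>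
  hP <| (Ideal.eq_top_iff_one P).2 <| by
    obtain ⟨u, v, huv⟩ := Nat.isCoprime_iff_coprime.2 hm
    have hone : (u : R) * m + v * Ideal.absNorm P = 1 := by
      exact_mod_cast congrArg (Int.cast (R := R)) huv
    exact hone ▸ P.add_mem (P.mul_mem_left _ hmP) (P.mul_mem_left _ (Ideal.absNorm_mem P))

lemma exists_primeNotDvdThree_absNorm_eq {p : ℕ} (hp : p.Prime) (hp₁ : (p : ZMod 3) = 1) :
    ∃ P : PrimeNotDvdThree, Ideal.absNorm P.1.asIdeal = p := by
  have : IsCyclotomicExtension {3} ℚ k := CyclotomicField.isCyclotomicExtension 3 ℚ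
  obtain ⟨P, hP, hnorm⟩ := exists_isPrime_absNorm_eq k hp hp₁
  have hbot : P ≠ ⊥ := fun h => hp.ne_zero <| by rw [← hnorm, h, Ideal.absNorm_bot]
  refine ⟨⟨⟨P, hP, hbot⟩, fun hdvd => ?_⟩, hnorm⟩
  refine natCast_notMem_of_coprime_absNorm hP.ne_top (m := 3) ?_ ?_
  · rw [hnorm, Nat.coprime_comm, ← ZMod.isUnit_iff_coprime, hp₁]
    exact isUnit_one
  · simpa using Ideal.dvd_span_singleton.1 hdvd

/-! ### Sums of unimodular numbers -/

section Phase

variable {ι : Type*} {s : Finset ι}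

lemma norm_sum_exp_I_mul_sq (s : Finset ι) (θ : ι → ℝ) :
    ‖∑ j ∈ s, Complex.exp (Complex.I * θ j)‖ ^ 2 = ∑ i ∈ s, ∑ j ∈ s, Real.cos (θ i - θ j) := by
  have hre (i : ι) : (Complex.exp (Complex.I * θ i)).re = Real.cos (θ i) := by
    rw [mul_comm, Complex.exp_ofReal_mul_I_re]
  have him (i : ι) : (Complex.exp (Complex.I * θ i)).im = Real.sin (θ i) := by
    rw [mul_comm, Complex.exp_ofReal_mul_I_im]
  simp only [Complex.sq_norm, Complex.normSq_apply, Complex.re_sum, Complex.im_sum, hre, him,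
    Finset.sum_mul_sum, ← Finset.sum_add_distrib, ← Real.cos_sub]

lemma norm_sum_exp_I_mul_sq_le {θ : ι → ℝ} (hθ : ∀ i ∈ s, ∀ j ∈ s, |θ i - θ j| ≤ Real.pi) :
    ‖∑ j ∈ s, Complex.exp (Complex.I * θ j)‖ ^ 2 ≤
      (#s : ℝ) ^ 2 - 2 / Real.pi ^ 2 * ∑ i ∈ s, ∑ j ∈ s, (θ i - θ j) ^ 2 := by
  rw [norm_sum_exp_I_mul_sq]
  calc ∑ i ∈ s, ∑ j ∈ s, Real.cos (θ i - θ j)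
      ≤ ∑ i ∈ s, ∑ j ∈ s, (1 - 2 / Real.pi ^ 2 * (θ i - θ j) ^ 2) :=
        sum_le_sum fun i hi => sum_le_sum fun j hj =>
          Real.cos_le_one_sub_mul_cos_sq (hθ i hi j hj)
    _ = _ := by simp [sum_sub_distrib, mul_sum, sq]

lemma sum_sum_sub_sq (s : Finset ι) (x : ι → ℝ) :
    ∑ i ∈ s, ∑ j ∈ s, (x i - x j) ^ 2 = 2 * (#s * ∑ i ∈ s, x i ^ 2 - (∑ i ∈ s, x i) ^ 2) := by
  simp only [sub_sq, sum_sub_distrib, Finset.sum_add_distrib, Finset.sum_const,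
    nsmul_eq_mul, ← mul_sum, ← Finset.sum_mul]
  ring

lemma sum_sum_sub_sq_ge_of_abs_sub_le {x θ : ι → ℝ} {ε : ℝ} (h : ∀ i ∈ s, |θ i - x i| ≤ ε) :
    1 / 2 * ∑ i ∈ s, ∑ j ∈ s, (x i - x j) ^ 2 - 2 * (#s * ε) ^ 2 ≤
      ∑ i ∈ s, ∑ j ∈ s, (θ i - θ j) ^ 2 := by
  have hsq : ∑ i ∈ s, (θ i - x i) ^ 2 ≤ #s * ε ^ 2 := by
    rw [← nsmul_eq_mul]
    exact Finset.sum_le_card_nsmul _ _ _ fun i hi =>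
      sq_le_sq' (abs_le.1 (h i hi)).1 (abs_le.1 (h i hi)).2
  have herror : ∑ i ∈ s, ∑ j ∈ s, ((θ i - x i) - (θ j - x j)) ^ 2 ≤ 2 * (#s * ε) ^ 2 := by
    rw [sum_sum_sub_sq s fun i => θ i - x i]
    nlinarith [sq_nonneg (∑ i ∈ s, (θ i - x i)),
      mul_le_mul_of_nonneg_left hsq (Nat.cast_nonneg (α := ℝ) #s)]
  have hpair : ∑ i ∈ s, ∑ j ∈ s, (x i - x j) ^ 2 ≤ 2 * ∑ i ∈ s, ∑ j ∈ s, (θ i - θ j) ^ 2 +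
      2 * ∑ i ∈ s, ∑ j ∈ s, ((θ i - x i) - (θ j - x j)) ^ 2 := by
    simp only [mul_sum, ← Finset.sum_add_distrib]
    refine sum_le_sum fun i _ => sum_le_sum fun j _ => ?_
    linarith [sq_nonneg (θ i - θ j + ((θ i - x i) - (θ j - x j)))]
  linarith

lemma norm_phase (y a : ℂ) : ‖phase y a‖ = 1 := by
  rw [phase, neg_mul, ← mul_neg, ← Complex.ofReal_neg, Complex.norm_exp_I_mul_ofReal]

lemma norm_phase_sub_one_add_le (y a : ℂ) :
    ‖phase y a - 1 + Complex.I * ((conj y * a).re : ℂ)‖ ≤ 2 * (‖y‖ * ‖a‖) ^ 2 := by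
  set x : ℝ := -(conj y * a).re with hx
  have hx_le : |x| ≤ ‖y‖ * ‖a‖ := by
    rw [hx, abs_neg, ← RCLike.norm_conj y, ← norm_mul]
    exact Complex.abs_re_le_norm _
  have hphase : phase y a - 1 + Complex.I * ((conj y * a).re : ℂ) =
      Complex.exp (Complex.I * x) - 1 - Complex.I * x := by
    rw [phase, hx, Complex.ofReal_neg]
    ring_nf
  have hnorm : ‖Complex.I * (x : ℂ)‖ = |x| := by simp
  have hbound : ‖Complex.exp (Complex.I * x) - 1 - Complex.I * x‖ ≤ 2 * |x| ^ 2 := by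
    rcases le_total |x| 1 with hx₁ | hx₁
    · have := Complex.norm_exp_sub_one_sub_id_le (hnorm.trans_le hx₁)
      rw [hnorm] at this
      nlinarith [sq_nonneg |x|]
    · have := norm_sub_le (Complex.exp (Complex.I * x) - 1) (Complex.I * x)
      have := Real.norm_exp_I_mul_ofReal_sub_one_le (x := x)
      rw [Real.norm_eq_abs] at this
      nlinarith
  rw [hphase]
  exact hbound.trans (by gcongr)

lemma norm_sum_phase_sub_one_le (s : Finset ι) (y : ℂ) (a : ι → ℂ) :
    ‖∑ j ∈ s, (phase y (a j) - 1)‖ ≤ 2 * ‖y‖ ^ 2 * ∑ j ∈ s, ‖a j‖ ^ 2 + ‖y‖ * ‖∑ j ∈ s, a j‖ := by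
  have hsplit : ∑ j ∈ s, (phase y (a j) - 1) =
      ∑ j ∈ s, (phase y (a j) - 1 + Complex.I * ((conj y * a j).re : ℂ)) -
        Complex.I * ((conj y * ∑ j ∈ s, a j).re : ℂ) := by
    rw [Finset.sum_add_distrib, ← mul_sum, ← Complex.ofReal_sum, ← Complex.re_sum,
      ← mul_sum, add_sub_cancel_right]
  have hlinear : ‖Complex.I * ((conj y * ∑ j ∈ s, a j).re : ℂ)‖ ≤ ‖y‖ * ‖∑ j ∈ s, a j‖ := by
    rw [norm_mul, Complex.norm_I, one_mul, Complex.norm_real, Real.norm_eq_abs,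
      ← RCLike.norm_conj y, ← norm_mul]
    exact Complex.abs_re_le_norm _
  rw [hsplit]
  refine (norm_sub_le _ _).trans (add_le_add ?_ hlinear)
  rw [mul_sum]
  refine norm_sum_le_of_le _ fun j _ => (norm_phase_sub_one_add_le y (a j)).trans_eq (by ring)

end Phase

section RootsOfUnity

variable {n : ℕ} {ζ : ℂ}

lemma sum_re_pow_mul_eq_zero (hζ : IsPrimitiveRoot ζ n) (hn : 1 < n) (w : ℂ) :
    ∑ j ∈ range n, (ζ ^ j * w).re = 0 := by
  rw [← Complex.re_sum, ← Finset.sum_mul, hζ.geom_sum_eq_zero hn, zero_mul, Complex.zero_re]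

lemma sum_re_pow_mul_sq (hζ : IsPrimitiveRoot ζ n) (hn : 2 < n) (w : ℂ) :
    ∑ j ∈ range n, (ζ ^ j * w).re ^ 2 = n / 2 * ‖w‖ ^ 2 := by
  have hre_sq (z : ℂ) : z.re ^ 2 = ‖z‖ ^ 2 / 2 + (z ^ 2).re / 2 := by
    rw [Complex.sq_norm, Complex.normSq_apply, sq z, Complex.mul_re]
    ring
  have hnorm (j : ℕ) : ‖ζ ^ j * w‖ = ‖w‖ := by
    rw [norm_mul, norm_pow, hζ.norm'_eq_one (by omega), one_pow, one_mul]
  have hζ_sq : ζ ^ 2 ≠ 1 := hζ.pow_ne_one_of_pos_of_lt two_ne_zero hn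
  have hgeom : ∑ j ∈ range n, (ζ ^ j * w) ^ 2 = 0 := by
    have hroot : (ζ ^ 2) ^ n = 1 := by rw [pow_right_comm, hζ.pow_eq_one, one_pow]
    simp only [mul_pow, pow_right_comm ζ _ 2, ← Finset.sum_mul, geom_sum_eq hζ_sq, hroot, sub_self,
      zero_div, zero_mul]
  simp only [hre_sq, hnorm, Finset.sum_add_distrib, ← Finset.sum_div, ← Complex.re_sum, hgeom,
    Finset.sum_const, Finset.card_range, nsmul_eq_mul, Complex.zero_re]
  ring

lemma le_sum_sum_sub_sq_of_abs_sub_re_pow_mul_le (hζ : IsPrimitiveRoot ζ n) (hn : 2 < n) {w : ℂ}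
    {θ : ℕ → ℝ} (hθ : ∀ j, |θ j - (ζ ^ j * w).re| ≤ ‖w‖ / 4) :
    3 / 8 * (n * ‖w‖) ^ 2 ≤ ∑ i ∈ range n, ∑ j ∈ range n, (θ i - θ j) ^ 2 := by
  have h := sum_sum_sub_sq_ge_of_abs_sub_le (s := range n) fun j _ => hθ j
  rw [sum_sum_sub_sq, sum_re_pow_mul_sq hζ hn, sum_re_pow_mul_eq_zero hζ (by omega),
    Finset.card_range] at h
  exact le_of_eq_of_le (by ring) h

lemma norm_sum_exp_I_mul_le (hζ : IsPrimitiveRoot ζ n) (hn : 2 < n) {w : ℂ} (hw : ‖w‖ ≤ 1)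
    {θ : ℕ → ℝ} (hθ : ∀ j, |θ j - (ζ ^ j * w).re| ≤ ‖w‖ / 4) :
    ‖∑ j ∈ range n, Complex.exp (Complex.I * θ j)‖ ≤ n * (1 - ‖w‖ ^ 2 / 30) := by
  have hθ_le (j : ℕ) : |θ j| ≤ 5 / 4 := by
    have hre : |(ζ ^ j * w).re| ≤ ‖w‖ := by
      simpa [hζ.norm'_eq_one (by omega)] using Complex.abs_re_le_norm (ζ ^ j * w)
    linarith [abs_sub_abs_le_abs_sub (θ j) (ζ ^ j * w).re, hθ j]
  have hθ_sub (i j : ℕ) : |θ i - θ j| ≤ Real.pi := by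
    linarith [abs_sub (θ i) (θ j), hθ_le i, hθ_le j, Real.pi_gt_three]
  have hpi : 1 / 15 ≤ 2 / Real.pi ^ 2 * (3 / 8) := by
    rw [div_mul_eq_mul_div, le_div_iff₀ (by positivity)]
    nlinarith [Real.pi_pos, Real.pi_lt_d2]
  have hsq : ‖∑ j ∈ range n, Complex.exp (Complex.I * θ j)‖ ^ 2 ≤
      (n * (1 - ‖w‖ ^ 2 / 30)) ^ 2 := by
    calc ‖∑ j ∈ range n, Complex.exp (Complex.I * θ j)‖ ^ 2
        ≤ (n : ℝ) ^ 2 - 2 / Real.pi ^ 2 *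
            ∑ i ∈ range n, ∑ j ∈ range n, (θ i - θ j) ^ 2 := by
          simpa using norm_sum_exp_I_mul_sq_le fun i (_ : i ∈ range n) j _ => hθ_sub i j
      _ ≤ (n : ℝ) ^ 2 - 2 / Real.pi ^ 2 * (3 / 8 * (n * ‖w‖) ^ 2) := by
          gcongr
          exact le_sum_sum_sub_sq_of_abs_sub_re_pow_mul_le hζ hn hθ
      _ ≤ (n : ℝ) ^ 2 - 1 / 15 * (n * ‖w‖) ^ 2 := by
          rw [← mul_assoc]
          gcongr
      _ ≤ (n * (1 - ‖w‖ ^ 2 / 30)) ^ 2 := by nlinarith [sq_nonneg (n * ‖w‖ ^ 2)]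
  refine le_of_sq_le_sq hsq ?_
  have : 0 ≤ 1 - ‖w‖ ^ 2 / 30 := by nlinarith [norm_nonneg w]
  positivity

lemma norm_sum_phase_le (hζ : IsPrimitiveRoot ζ n) (hn : 2 < n) {y c : ℂ} {a : ℕ → ℂ}
    (ha : ∀ j, ‖a j - ζ ^ j * c‖ ≤ ‖c‖ / 4) (hyc : ‖y‖ * ‖c‖ ≤ 1) :
    ‖∑ j ∈ range n, phase y (a j)‖ ≤ n * (1 - (‖y‖ * ‖c‖) ^ 2 / 30) := by
  have hnorm : ‖-(conj y * c)‖ = ‖y‖ * ‖c‖ := by rw [norm_neg, norm_mul, RCLike.norm_conj]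
  have hphase (j : ℕ) :
      phase y (a j) = Complex.exp (Complex.I * (-(conj y * a j).re : ℝ)) := by
    rw [phase, Complex.ofReal_neg, neg_mul_comm]
  have hclose (j : ℕ) :
      |-(conj y * a j).re - (ζ ^ j * -(conj y * c)).re| ≤ ‖-(conj y * c)‖ / 4 := by
    have : -(conj y * a j).re - (ζ ^ j * -(conj y * c)).re =
        (-(conj y * (a j - ζ ^ j * c))).re := by
      rw [← Complex.neg_re, ← Complex.sub_re]
      ring_nf
    rw [this]
    refine (Complex.abs_re_le_norm _).trans ?_
    rw [hnorm, norm_neg, norm_mul, RCLike.norm_conj, mul_div_assoc]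
    exact mul_le_mul_of_nonneg_left (ha j) (norm_nonneg y)
  simp only [hphase, ← hnorm]
  exact norm_sum_exp_I_mul_le hζ hn (hnorm.trans_le hyc) hclose

end RootsOfUnity

section EulerFactor

lemma isPrimitiveRoot_zeta3 : IsPrimitiveRoot zeta3 3 := by
  simpa [zeta3] using Complex.isPrimitiveRoot_exp 3 (by norm_num)

lemma norm_zeta3_pow (j : ℕ) : ‖zeta3 ^ j‖ = 1 := by
  rw [norm_pow, isPrimitiveRoot_zeta3.norm'_eq_one three_ne_zero, one_pow]

variable {a : ℕ → ℕ → ℂ} {y : ℂ} {P : PrimeNotDvdThree}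

lemma eulerFactor_sub_one (a : ℕ → ℕ → ℂ) (y : ℂ) (P : PrimeNotDvdThree) :
    eulerFactor a y P - 1 = 1 / 3 * ((Ideal.absNorm P.1.asIdeal : ℂ) /
      ((Ideal.absNorm P.1.asIdeal : ℂ) + 1)) *
        ∑ j ∈ range 3, (phase y (a (Ideal.absNorm P.1.asIdeal) j) - 1) := by
  have hN : (Ideal.absNorm P.1.asIdeal : ℂ) + 1 ≠ 0 := Nat.cast_add_one_ne_zero _
  rw [eulerFactor, sum_sub_distrib, Finset.sum_const, Finset.card_range]
  field_simp
  ring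

lemma norm_natCast_add_one (N : ℕ) : ‖(N : ℂ) + 1‖ = N + 1 := by
  exact_mod_cast Complex.norm_natCast (N + 1)

lemma norm_eulerFactor_sub_one_le (a : ℕ → ℕ → ℂ) (y : ℂ) (P : PrimeNotDvdThree) :
    ‖eulerFactor a y P - 1‖ ≤
      ‖∑ j ∈ range 3, (phase y (a (Ideal.absNorm P.1.asIdeal) j) - 1)‖ := by
  rw [eulerFactor_sub_one, norm_mul]
  refine mul_le_of_le_one_left (norm_nonneg _) ?_
  rw [norm_mul, norm_div, norm_div, norm_natCast_add_one, Complex.norm_natCast, norm_one,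
    Complex.norm_ofNat]
  have := div_le_one_of_le₀ (a := (Ideal.absNorm P.1.asIdeal : ℝ))
    (b := Ideal.absNorm P.1.asIdeal + 1) (by linarith) (by positivity)
  linarith

lemma norm_eulerFactor_le {δ : ℝ} (hδ : 0 ≤ δ)
    (h : ‖∑ j ∈ range 3, phase y (a (Ideal.absNorm P.1.asIdeal) j)‖ ≤ 3 * (1 - δ)) :
    ‖eulerFactor a y P‖ ≤ 1 - δ / 2 := by
  rw [eulerFactor]
  have hN₁ : 1 ≤ Ideal.absNorm P.1.asIdeal := one_le_two.trans (two_le_absNorm P.1)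
  generalize Ideal.absNorm P.1.asIdeal = N at h hN₁ ⊢
  have hweight : 1 / 2 ≤ (N : ℝ) / (N + 1) := by
    rw [div_le_div_iff₀ two_pos (by positivity)]
    linarith [Nat.one_le_cast (α := ℝ).2 hN₁]
  calc ‖1 / ((N : ℂ) + 1) + 1 / 3 * (N / (N + 1)) * ∑ j ∈ range 3, phase y (a N j)‖
      ≤ 1 / ((N : ℝ) + 1) + 1 / 3 * (N / (N + 1)) *
          ‖∑ j ∈ range 3, phase y (a N j)‖ := by
        refine (norm_add_le _ _).trans_eq ?_
        simp only [norm_mul, norm_div, norm_one, norm_natCast_add_one, Complex.norm_natCast,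
          Complex.norm_ofNat]
    _ ≤ 1 / ((N : ℝ) + 1) + 1 / 3 * (N / (N + 1)) * (3 * (1 - δ)) := by gcongr
    _ = 1 - (N : ℝ) / (N + 1) * δ := by field_simp; ring
    _ ≤ 1 - 1 / 2 * δ := by gcongr
    _ = 1 - δ / 2 := by ring

lemma norm_eulerFactor_le_one (a : ℕ → ℕ → ℂ) (y : ℂ) (P : PrimeNotDvdThree) :
    ‖eulerFactor a y P‖ ≤ 1 := by
  refine (norm_eulerFactor_le le_rfl ?_).trans_eq (by norm_num)
  exact (norm_sum_le_of_le _ fun j _ => (norm_phase y _).le).trans_eq (by simp)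

lemma norm_eulerFactor_le_exp {c : ℂ}
    (ha : ∀ j, ‖a (Ideal.absNorm P.1.asIdeal) j - zeta3 ^ j * c‖ ≤ ‖c‖ / 4)
    (hyc : ‖y‖ * ‖c‖ ≤ 1) :
    ‖eulerFactor a y P‖ ≤ Real.exp (-((‖y‖ * ‖c‖) ^ 2 / 60)) := by
  have hfactor := norm_eulerFactor_le (δ := (‖y‖ * ‖c‖) ^ 2 / 30) (by positivity)
    (norm_sum_phase_le isPrimitiveRoot_zeta3 (by norm_num) ha hyc)
  linarith [Real.add_one_le_exp (-((‖y‖ * ‖c‖) ^ 2 / 60))]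

end EulerFactor

/-! ### The coefficients -/

/-- `a_{N,j} = ζ₃^j c_N (1 + O(N^{-σ}))` for `N ≥ 2`, with `|c_N| = (log N)^κ N^{-σ}`. Both families
of coefficients have this shape with `σ = Re s`: `κ = 0` for `log L` and `κ = 1` for `L'/L`. -/
def HasLeadingTerm (a : ℕ → ℕ → ℂ) (κ σ : ℝ) : Prop :=
  ∃ (c : ℕ → ℂ) (D : ℝ), 0 ≤ D ∧ ∀ N : ℕ, 2 ≤ N →
    ‖c N‖ = Real.log N ^ κ * (N : ℝ) ^ (-σ) ∧
    ∀ j, ‖a N j - zeta3 ^ j * c N‖ ≤ D * ‖c N‖ * (N : ℝ) ^ (-σ)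

lemma norm_natCast_cpow_neg {N : ℕ} (hN : 2 ≤ N) (s : ℂ) :
    ‖(N : ℂ) ^ (-s)‖ = (N : ℝ) ^ (-s.re) := by
  rw [Complex.norm_natCast_cpow_of_pos (by omega), Complex.neg_re]

lemma natCast_rpow_neg_le_two_rpow_neg {N : ℕ} (hN : 2 ≤ N) {σ : ℝ} (hσ : 0 ≤ σ) :
    (N : ℝ) ^ (-σ) ≤ (2 : ℝ) ^ (-σ) :=
  Real.rpow_le_rpow_of_nonpos two_pos (by exact_mod_cast hN) (neg_nonpos.2 hσ)

lemma hasLeadingTerm_aLog {s : ℂ} (hs : 0 < s.re) : HasLeadingTerm (aLog s) 0 s.re := by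
  have h₂ : (2 : ℝ) ^ (-s.re) < 1 := Real.rpow_lt_one_of_one_lt_of_neg one_lt_two (by linarith)
  refine ⟨fun N => -(N : ℂ) ^ (-s), (1 - (2 : ℝ) ^ (-s.re))⁻¹, inv_nonneg.2 (by linarith),
    fun N hN => ⟨by simp [norm_natCast_cpow_neg hN], fun j => ?_⟩⟩
  set r : ℝ := (N : ℝ) ^ (-s.re)
  have hr₁ : r < 1 :=
    Real.rpow_lt_one_of_one_lt_of_neg (by exact_mod_cast (by omega : 1 < N)) (by linarith)
  have hnorm : ‖zeta3 ^ j * -(N : ℂ) ^ (-s)‖ = r := by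
    rw [norm_mul, norm_zeta3_pow, one_mul, norm_neg, norm_natCast_cpow_neg hN]
  calc ‖aLog s N j - zeta3 ^ j * -(N : ℂ) ^ (-s)‖
      = ‖Complex.log (1 + zeta3 ^ j * -(N : ℂ) ^ (-s)) - zeta3 ^ j * -(N : ℂ) ^ (-s)‖ := by
        rw [aLog, mul_neg, sub_eq_add_neg 1]
    _ ≤ r ^ 2 * (1 - r)⁻¹ / 2 :=
        hnorm ▸ Complex.norm_log_one_add_sub_self_le (hnorm.trans_lt hr₁)
    _ ≤ r ^ 2 * (1 - r)⁻¹ := half_le_self (mul_nonneg (sq_nonneg r) (inv_nonneg.2 (by linarith)))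
    _ ≤ r ^ 2 * (1 - (2 : ℝ) ^ (-s.re))⁻¹ := by
        gcongr
        exact natCast_rpow_neg_le_two_rpow_neg hN hs.le
    _ = (1 - (2 : ℝ) ^ (-s.re))⁻¹ * ‖-(N : ℂ) ^ (-s)‖ * r := by
        rw [norm_neg, norm_natCast_cpow_neg hN]
        ring

lemma aLogDeriv_eq (s : ℂ) {N : ℕ} (hN : N ≠ 0) (j : ℕ) :
    aLogDeriv s N j =
      zeta3 ^ j * ((Real.log N : ℂ) * (N : ℂ) ^ (-s)) / (1 - zeta3 ^ j * (N : ℂ) ^ (-s)) := by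
  have hNs : (N : ℂ) ^ s ≠ 0 := by simp [Complex.cpow_eq_zero_iff, hN]
  have hden : (N : ℂ) ^ s - zeta3 ^ j = (N : ℂ) ^ s * (1 - zeta3 ^ j * (N : ℂ) ^ (-s)) := by
    rw [Complex.cpow_neg]
    field_simp
  rw [aLogDeriv, hden, Complex.cpow_neg, ← div_div]
  ring

lemma hasLeadingTerm_aLogDeriv {s : ℂ} (hs : 0 < s.re) :
    HasLeadingTerm (aLogDeriv s) 1 s.re := by
  have h₂ : (2 : ℝ) ^ (-s.re) < 1 := Real.rpow_lt_one_of_one_lt_of_neg one_lt_two (by linarith)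
  refine ⟨fun N => (Real.log N : ℂ) * (N : ℂ) ^ (-s), (1 - (2 : ℝ) ^ (-s.re))⁻¹,
    inv_nonneg.2 (by linarith), fun N hN => ⟨?_, fun j => ?_⟩⟩
  · rw [norm_mul, norm_natCast_cpow_neg hN, Complex.norm_real, Real.rpow_one,
      Real.norm_of_nonneg (Real.log_natCast_nonneg N)]
  set c : ℂ := (Real.log N : ℂ) * (N : ℂ) ^ (-s)
  set w : ℂ := zeta3 ^ j * (N : ℂ) ^ (-s) with hw
  have hw_norm : ‖w‖ = (N : ℝ) ^ (-s.re) := by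
    rw [hw, norm_mul, norm_zeta3_pow, one_mul, norm_natCast_cpow_neg hN]
  have hw₁ : ‖w‖ < 1 := hw_norm.trans_lt <|
    Real.rpow_lt_one_of_one_lt_of_neg (by exact_mod_cast (by omega : 1 < N)) (by linarith)
  have hw_sub : 1 - ‖w‖ ≤ ‖1 - w‖ := by simpa using norm_sub_norm_le 1 w
  have hw_ne : 1 - w ≠ 0 := norm_pos_iff.1 (by linarith)
  calc ‖aLogDeriv s N j - zeta3 ^ j * c‖
      = ‖zeta3 ^ j * (c * w * (1 - w)⁻¹)‖ := by
        rw [aLogDeriv_eq s (by omega), ← hw, mul_div_assoc]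
        change ‖zeta3 ^ j * (c / (1 - w)) - zeta3 ^ j * c‖ = _
        congr 1
        field_simp
        ring
    _ = ‖c‖ * ‖w‖ * ‖1 - w‖⁻¹ := by
        rw [norm_mul, norm_mul, norm_mul, norm_inv, norm_zeta3_pow, one_mul]
    _ ≤ ‖c‖ * ‖w‖ * (1 - (2 : ℝ) ^ (-s.re))⁻¹ := by
        have := natCast_rpow_neg_le_two_rpow_neg hN hs.le
        gcongr
        linarith
    _ = (1 - (2 : ℝ) ^ (-s.re))⁻¹ * ‖c‖ * (N : ℝ) ^ (-s.re) := by
        rw [hw_norm]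
        ring

lemma norm_sum_phase_sub_one_le_of_norm_sub_le {y c : ℂ} {a : ℕ → ℂ} {D ε : ℝ} (hD : 0 ≤ D)
    (hε : ε ≤ 1) (ha : ∀ j, ‖a j - zeta3 ^ j * c‖ ≤ D * ‖c‖ * ε) :
    ‖∑ j ∈ range 3, (phase y (a j) - 1)‖ ≤
      6 * (‖y‖ * (1 + D)) ^ 2 * ‖c‖ ^ 2 + 3 * ‖y‖ * D * (‖c‖ * ε) := by
  have hnorm (j : ℕ) : ‖a j‖ ≤ (1 + D) * ‖c‖ := by
    calc ‖a j‖ ≤ ‖zeta3 ^ j * c‖ + ‖a j - zeta3 ^ j * c‖ := norm_le_norm_add_norm_sub' _ _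
      _ ≤ ‖c‖ + D * ‖c‖ * ε := by
          rw [norm_mul, norm_zeta3_pow, one_mul]
          gcongr
          exact ha j
      _ ≤ ‖c‖ + D * ‖c‖ :=
          add_le_add_right (mul_le_of_le_one_right (by positivity) hε) _
      _ = (1 + D) * ‖c‖ := by ring
  have hsum : ‖∑ j ∈ range 3, a j‖ ≤ 3 * (D * ‖c‖ * ε) := by
    have hgeom : ∑ j ∈ range 3, a j = ∑ j ∈ range 3, (a j - zeta3 ^ j * c) := by
      rw [sum_sub_distrib, ← Finset.sum_mul,
        isPrimitiveRoot_zeta3.geom_sum_eq_zero (by norm_num), zero_mul, sub_zero]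
    rw [hgeom]
    exact (norm_sum_le_of_le _ fun j _ => ha j).trans_eq (by simp)
  calc ‖∑ j ∈ range 3, (phase y (a j) - 1)‖
      ≤ 2 * ‖y‖ ^ 2 * ∑ j ∈ range 3, ‖a j‖ ^ 2 + ‖y‖ * ‖∑ j ∈ range 3, a j‖ :=
        norm_sum_phase_sub_one_le _ y a
    _ ≤ 2 * ‖y‖ ^ 2 * ∑ _j ∈ range 3, ((1 + D) * ‖c‖) ^ 2 +
          ‖y‖ * (3 * (D * ‖c‖ * ε)) := by
        gcongr with j _
        exact hnorm j
    _ = 6 * (‖y‖ * (1 + D)) ^ 2 * ‖c‖ ^ 2 + 3 * ‖y‖ * D * (‖c‖ * ε) := by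
        rw [Finset.sum_const, Finset.card_range, nsmul_eq_mul]
        push_cast
        ring

lemma HasLeadingTerm.multipliable_eulerFactor {a : ℕ → ℕ → ℂ} {κ σ : ℝ}
    (ha : HasLeadingTerm a κ σ) (hσ : 1 / 2 < σ) (y : ℂ) : Multipliable (eulerFactor a y) := by
  obtain ⟨c, D, hD, hc⟩ := ha
  have hinj : Function.Injective fun P : PrimeNotDvdThree => P.1.asIdeal := fun _ _ h =>
    Subtype.ext (IsDedekindDomain.HeightOneSpectrum.ext h)
  have hsum (r : ℝ) := (summable_log_absNorm_rpow_mul_rpow_neg (K := k) r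
    (by linarith : 1 < 2 * σ)).comp_injective hinj
  have hbound := ((hsum (2 * κ)).mul_left (6 * (‖y‖ * (1 + D)) ^ 2)).add
    ((hsum κ).mul_left (3 * ‖y‖ * D))
  suffices h : Multipliable fun P => 1 + (eulerFactor a y P - 1) by
    simpa only [add_sub_cancel] using h
  refine multipliable_one_add_of_summable
    (hbound.of_nonneg_of_le (fun _ => norm_nonneg _) fun P => ?_)
  refine (norm_eulerFactor_sub_one_le a y P).trans ?_
  have hN := two_le_absNorm P.1
  simp only [Function.comp_apply]
  generalize Ideal.absNorm P.1.asIdeal = N at hN ⊢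
  obtain ⟨hcN, haN⟩ := hc N hN
  have hN₁ : (1 : ℝ) ≤ N := by exact_mod_cast one_le_two.trans hN
  have hsq : ‖c N‖ ^ 2 = Real.log N ^ (2 * κ) * (N : ℝ) ^ (-(2 * σ)) := by
    rw [hcN, mul_pow, ← Real.rpow_mul_natCast (Real.log_natCast_nonneg N),
      ← Real.rpow_mul_natCast (Nat.cast_nonneg N)]
    push_cast
    ring_nf
  have hmul : ‖c N‖ * (N : ℝ) ^ (-σ) = Real.log N ^ κ * (N : ℝ) ^ (-(2 * σ)) := by
    rw [hcN, mul_assoc, ← Real.rpow_add (by linarith)]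
    ring_nf
  rw [← hsq, ← hmul]
  exact norm_sum_phase_sub_one_le_of_norm_sub_le hD
    (Real.rpow_le_one_of_one_le_of_nonpos hN₁ (by linarith)) haN

/-! ### Decay -/

lemma norm_tprod_le_prod {ι R : Type*} [NormedCommRing R] [NormMulClass R] [NormOneClass R]
    {f : ι → R} (hf : Multipliable f) (h₁ : ∀ i, ‖f i‖ ≤ 1) (S : Finset ι) :
    ‖∏' i, f i‖ ≤ ∏ i ∈ S, ‖f i‖ := by
  classical
  refine le_of_tendsto hf.hasProd.norm (eventually_atTop.2 ⟨S, fun T hST => ?_⟩)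
  rw [← Finset.prod_sdiff hST]
  exact mul_le_of_le_one_left (Finset.prod_nonneg fun _ _ => norm_nonneg _)
    (Finset.prod_le_one (fun _ _ => norm_nonneg _) fun i _ => h₁ i)

lemma norm_charProduct_le_exp {a : ℕ → ℕ → ℂ} {c : ℕ → ℂ} {y : ℂ} {u : ℝ} {S : Finset ℕ}
    (hmul : Multipliable (eulerFactor a y)) (hS : ∀ p ∈ S, p.Prime ∧ (p : ZMod 3) = 1)
    (ha : ∀ p ∈ S, ∀ j, ‖a p j - zeta3 ^ j * c p‖ ≤ ‖c p‖ / 4) (hu : 0 ≤ u)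
    (hlow : ∀ p ∈ S, u ≤ ‖y‖ * ‖c p‖) (hup : ∀ p ∈ S, ‖y‖ * ‖c p‖ ≤ 1) :
    ‖charProduct a y‖ ≤ Real.exp (-(u ^ 2 / 60 * #S)) := by
  have hex (p : S) : ∃ P : PrimeNotDvdThree, Ideal.absNorm P.1.asIdeal = p :=
    exists_primeNotDvdThree_absNorm_eq (hS p p.2).1 (hS p p.2).2
  choose Q hQ using hex
  have hinj : Function.Injective Q := fun p q h => Subtype.ext (by rw [← hQ p, ← hQ q, h])
  have hfactor (p : S) : ‖eulerFactor a y (Q p)‖ ≤ Real.exp (-(u ^ 2 / 60)) := by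
    refine (norm_eulerFactor_le_exp (c := c p) ?_ (hup p p.2)).trans ?_
    · rw [hQ p]
      exact ha p p.2
    · gcongr
      exact hlow p p.2
  calc ‖charProduct a y‖ = ‖∏' P, eulerFactor a y P‖ := by
        rw [charProduct, norm_mul, norm_phase, one_mul]
    _ ≤ ∏ P ∈ Finset.univ.map ⟨Q, hinj⟩, ‖eulerFactor a y P‖ :=
        norm_tprod_le_prod hmul (norm_eulerFactor_le_one a y) _
    _ = ∏ p : S, ‖eulerFactor a y (Q p)‖ := Finset.prod_map _ _ _
    _ ≤ ∏ _p : S, Real.exp (-(u ^ 2 / 60)) :=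
        Finset.prod_le_prod (fun _ _ => norm_nonneg _) fun p _ => hfactor p
    _ = Real.exp (-(u ^ 2 / 60 * #S)) := by
        rw [Finset.prod_const, Finset.card_univ, Fintype.card_coe, ← Real.exp_nat_mul]
        ring_nf

section PrimeScale

variable {κ σ t : ℝ}

/-- The size of the rational primes `p` with `t (log p)^κ p^{-σ} ≍ 1`. The constant `(2 / σ) ^ κ`
makes this quantity at most `1` for `p` beyond the scale. -/
noncomputable def primeScale (κ σ t : ℝ) : ℝ := ((2 / σ) ^ κ * t * Real.log t ^ κ) ^ (1 / σ)

lemma primeScale_pos (hσ : 0 < σ) (ht : 1 < t) : 0 < primeScale κ σ t := by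
  have := Real.log_pos ht
  unfold primeScale
  positivity

lemma primeScale_eq (hσ : 0 < σ) (ht : 1 < t) :
    primeScale κ σ t = (2 / σ) ^ (κ / σ) * t ^ (1 / σ) * Real.log t ^ (κ / σ) := by
  have := Real.log_pos ht
  rw [primeScale, Real.mul_rpow (by positivity) (by positivity),
    Real.mul_rpow (by positivity) (by positivity), ← Real.rpow_mul (by positivity),
    ← Real.rpow_mul this.le, mul_one_div]

lemma primeScale_rpow_neg (hσ : 0 < σ) (ht : 1 < t) :
    primeScale κ σ t ^ (-σ) = ((2 / σ) ^ κ * t * Real.log t ^ κ)⁻¹ := by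
  have := Real.log_pos ht
  rw [primeScale, ← Real.rpow_mul (by positivity), mul_neg, one_div_mul_cancel hσ.ne',
    Real.rpow_neg_one]

lemma tendsto_log_mul_primeScale_div_log (κ : ℝ) (hσ : 0 < σ) {b : ℝ} (hb : 0 < b) :
    Tendsto (fun t => Real.log (b * primeScale κ σ t) / Real.log t) atTop (𝓝 (1 / σ)) := by
  have hconst (r : ℝ) : Tendsto (fun t => r / Real.log t) atTop (𝓝 0) :=
    Real.tendsto_log_atTop.const_div_atTop r
  have hloglog : Tendsto (fun t => Real.log (Real.log t) / Real.log t) atTop (𝓝 0) :=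
    Real.isLittleO_log_id_atTop.tendsto_div_nhds_zero.comp Real.tendsto_log_atTop
  have hlim := (hconst (Real.log b)).add
    ((((hconst (κ * Real.log (2 / σ))).add_const 1).add (hloglog.const_mul κ)).const_mul (1 / σ))
  simp only [mul_zero, zero_add, add_zero, mul_one] at hlim
  refine hlim.congr' ?_
  filter_upwards [eventually_gt_atTop 1] with t ht
  have hlog := Real.log_pos ht
  rw [Real.log_mul hb.ne' (primeScale_pos hσ ht).ne', primeScale, Real.log_rpow (by positivity),
    Real.log_mul (by positivity) (by positivity), Real.log_mul (by positivity) (by positivity),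
    Real.log_rpow (by positivity), Real.log_rpow hlog]
  field_simp

lemma tendsto_primeScale_atTop (κ : ℝ) (hσ : 0 < σ) : Tendsto (primeScale κ σ) atTop atTop := by
  have hratio := tendsto_log_mul_primeScale_div_log κ hσ one_pos
  refine tendsto_atTop_mono' _ ?_
    (hratio.pos_mul_atTop (one_div_pos.2 hσ) Real.tendsto_log_atTop)
  filter_upwards [eventually_gt_atTop 1] with t ht
  rw [div_mul_cancel₀ _ (Real.log_pos ht).ne', one_mul]
  exact Real.log_le_self (primeScale_pos hσ ht).le

lemma eventually_le_log_primeScale (κ : ℝ) (hσ : 0 < σ) :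
    ∀ᶠ t in atTop, Real.log t / (2 * σ) ≤ Real.log (primeScale κ σ t) := by
  have hlt : 1 / (2 * σ) < 1 / σ := one_div_lt_one_div_of_lt hσ (by linarith)
  filter_upwards [eventually_gt_atTop 1,
    (tendsto_log_mul_primeScale_div_log κ hσ one_pos).eventually (eventually_ge_nhds hlt)]
    with t ht h
  rwa [one_mul, le_div_iff₀ (Real.log_pos ht), one_div_mul_eq_div] at h

lemma eventually_log_mul_primeScale_le (κ : ℝ) (hσ : 0 < σ) {b : ℝ} (hb : 0 < b) :
    ∀ᶠ t in atTop, Real.log (b * primeScale κ σ t) ≤ 2 / σ * Real.log t := by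
  have hlt : 1 / σ < 2 / σ := by gcongr; exact one_lt_two
  filter_upwards [eventually_gt_atTop 1,
    (tendsto_log_mul_primeScale_div_log κ hσ hb).eventually (eventually_le_nhds hlt)] with t ht h
  rwa [div_le_iff₀ (Real.log_pos ht)] at h

lemma eventually_mul_log_rpow_mul_rpow_neg_le_one (hκ : 0 ≤ κ) (hσ : 0 < σ) {b : ℝ} (hb : 0 < b) :
    ∀ᶠ t in atTop, ∀ x ∈ Set.Ioc (primeScale κ σ t) (b * primeScale κ σ t),
      t * (Real.log x ^ κ * x ^ (-σ)) ≤ 1 := by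
  filter_upwards [eventually_gt_atTop 1, eventually_log_mul_primeScale_le κ hσ hb,
    (tendsto_primeScale_atTop κ hσ).eventually_ge_atTop 1] with t ht hlog_le hscale x hx
  have hlog := Real.log_pos ht
  have hscale_pos := primeScale_pos (κ := κ) hσ ht
  have hx_pos := hscale_pos.trans hx.1
  have hlogx : 0 ≤ Real.log x := Real.log_nonneg (hscale.trans hx.1.le)
  have hlogx_le : Real.log x ≤ 2 / σ * Real.log t := (Real.log_le_log hx_pos hx.2).trans hlog_le
  have hpow : x ^ (-σ) ≤ primeScale κ σ t ^ (-σ) :=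
    Real.rpow_le_rpow_of_nonpos hscale_pos hx.1.le (by linarith)
  calc t * (Real.log x ^ κ * x ^ (-σ))
      ≤ t * ((2 / σ * Real.log t) ^ κ * primeScale κ σ t ^ (-σ)) := by
        gcongr
    _ = 1 := by
        rw [primeScale_rpow_neg hσ ht, Real.mul_rpow (by positivity) hlog.le]
        field_simp

lemma eventually_le_mul_log_rpow_mul_rpow_neg (hκ : 0 ≤ κ) (hσ : 0 < σ) {b : ℝ} (hb : 0 < b) :
    ∀ᶠ t in atTop, ∀ x ∈ Set.Ioc (primeScale κ σ t) (b * primeScale κ σ t),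
      b ^ (-σ) / 4 ^ κ ≤ t * (Real.log x ^ κ * x ^ (-σ)) := by
  filter_upwards [eventually_gt_atTop 1, eventually_le_log_primeScale κ hσ] with t ht hle_log x hx
  have hlog := Real.log_pos ht
  have hscale := primeScale_pos (κ := κ) hσ ht
  have hle_logx : Real.log t / (2 * σ) ≤ Real.log x :=
    hle_log.trans (Real.log_le_log hscale hx.1.le)
  have hlogx : 0 ≤ Real.log x := le_trans (by positivity) hle_logx
  have hpow : (b * primeScale κ σ t) ^ (-σ) ≤ x ^ (-σ) :=
    Real.rpow_le_rpow_of_nonpos (hscale.trans hx.1) hx.2 (by linarith)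
  calc b ^ (-σ) / 4 ^ κ = t * ((Real.log t / (2 * σ)) ^ κ * (b * primeScale κ σ t) ^ (-σ)) := by
        have hfour : Real.log t / (2 * σ) = 2 / σ * Real.log t / 4 := by ring
        rw [Real.mul_rpow hb.le hscale.le, primeScale_rpow_neg hσ ht, hfour,
          Real.div_rpow (by positivity) (by norm_num), Real.mul_rpow (by positivity) hlog.le]
        field_simp
    _ ≤ t * (Real.log x ^ κ * x ^ (-σ)) := by
        gcongr

lemma eventually_le_primeScale_div_log (κ : ℝ) (hσ : 0 < σ) {b : ℝ} (hb : 1 < b) :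
    ∀ᶠ t in atTop, σ / 2 * (2 / σ) ^ (κ / σ) * t ^ (1 / σ) * Real.log t ^ (κ / σ - 1) ≤
      primeScale κ σ t / Real.log (b * primeScale κ σ t) := by
  filter_upwards [eventually_gt_atTop 1, eventually_log_mul_primeScale_le κ hσ (by linarith),
    (tendsto_primeScale_atTop κ hσ).eventually_ge_atTop 1] with t ht hlog_le hscale
  have hlog := Real.log_pos ht
  calc σ / 2 * (2 / σ) ^ (κ / σ) * t ^ (1 / σ) * Real.log t ^ (κ / σ - 1)
      = primeScale κ σ t / (2 / σ * Real.log t) := by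
        rw [primeScale_eq hσ ht, Real.rpow_sub_one hlog.ne']
        field_simp
    _ ≤ primeScale κ σ t / Real.log (b * primeScale κ σ t) := by
        have : 0 < Real.log (b * primeScale κ σ t) := Real.log_pos (by nlinarith)
        gcongr

end PrimeScale

lemma eventually_forall_gt_primeScale (κ : ℝ) {σ : ℝ} (hσ : 0 < σ) {p : ℝ → Prop}
    (hp : ∀ᶠ x in atTop, p x) : ∀ᶠ t in atTop, ∀ x, primeScale κ σ t < x → p x := by
  filter_upwards [(tendsto_primeScale_atTop κ hσ).eventually (eventually_forall_ge_atTop.2 hp)]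
    with t h x hx
  exact h x hx.le

variable {a : ℕ → ℕ → ℂ} {κ σ : ℝ}

lemma HasLeadingTerm.eventually_norm_charProduct_le (ha : HasLeadingTerm a κ σ) (hκ : 0 ≤ κ)
    (hσ : 1 / 2 < σ) {b : ℝ} (hb : 0 < b) :
    ∀ᶠ y in Bornology.cobounded ℂ, ∀ S : Finset ℕ, (∀ p ∈ S, p.Prime ∧ (p : ZMod 3) = 1) →
      (∀ p ∈ S, (p : ℝ) ∈ Set.Ioc (primeScale κ σ ‖y‖) (b * primeScale κ σ ‖y‖)) →
      ‖charProduct a y‖ ≤ Real.exp (-((b ^ (-σ) / 4 ^ κ) ^ 2 / 60 * #S)) := by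
  have hσ₀ : 0 < σ := by linarith
  have hmul := ha.multipliable_eulerFactor hσ
  obtain ⟨c, D, -, hc⟩ := ha
  have herror : ∀ᶠ x : ℝ in atTop, D * x ^ (-σ) ≤ 1 / 4 :=
    ((tendsto_rpow_neg_atTop hσ₀).const_mul D).eventually_le_const (by norm_num)
  filter_upwards [tendsto_norm_cobounded_atTop.eventually
      (eventually_forall_gt_primeScale κ hσ₀ herror),
    tendsto_norm_cobounded_atTop.eventually (eventually_le_mul_log_rpow_mul_rpow_neg hκ hσ₀ hb),
    tendsto_norm_cobounded_atTop.eventually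
      (eventually_mul_log_rpow_mul_rpow_neg_le_one hκ hσ₀ hb)]
    with y herror hlow hup S hS hS_mem
  refine norm_charProduct_le_exp (c := c) (hmul y) hS (fun p hp j => ?_) (by positivity)
    (fun p hp => ?_) (fun p hp => ?_)
  · refine ((hc p (hS p hp).1.two_le).2 j).trans ?_
    linarith [mul_le_mul_of_nonneg_left (herror p (hS_mem p hp).1) (norm_nonneg (c p))]
  · rw [(hc p (hS p hp).1.two_le).1]
    exact hlow p (hS_mem p hp)
  · rw [(hc p (hS p hp).1.two_le).1]
    exact hup p (hS_mem p hp)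

lemma exists_norm_charProduct_le (hκ : 0 ≤ κ) (hσ : 1 / 2 < σ) :
    ∃ C : ℝ, 0 < C ∧ ∀ a, HasLeadingTerm a κ σ → ∀ᶠ y in Bornology.cobounded ℂ,
      ‖charProduct a y‖ ≤ Real.exp (-C * ‖y‖ ^ (1 / σ) * Real.log ‖y‖ ^ (κ / σ - 1)) := by
  obtain ⟨B, hB, hprimes⟩ := exists_le_log_mul_card_primes (q := 3) (a := 1) isUnit_one
  have hσ₀ : 0 < σ := by linarith
  have hB₀ : 0 < B := by linarith
  set u : ℝ := B ^ (-σ) / 4 ^ κ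
  refine ⟨u ^ 2 / 60 * (σ / 2 * (2 / σ) ^ (κ / σ)), by positivity, fun a ha => ?_⟩
  filter_upwards [ha.eventually_norm_charProduct_le hκ hσ hB₀,
    tendsto_norm_cobounded_atTop.eventually ((tendsto_primeScale_atTop κ hσ₀).eventually hprimes),
    tendsto_norm_cobounded_atTop.eventually
      ((tendsto_primeScale_atTop κ hσ₀).eventually_ge_atTop 1),
    tendsto_norm_cobounded_atTop.eventually (eventually_le_primeScale_div_log κ hσ₀ hB)]
    with y hdecay hcard hX hmain
  set X := primeScale κ σ ‖y‖
  set S := {p ∈ Ioc ⌊X⌋₊ ⌊B * X⌋₊ | p.Prime ∧ ((p : ℕ) : ZMod 3) = 1}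
  have hlog : 0 < Real.log (B * X) := Real.log_pos (by nlinarith)
  have hS_mem (p : ℕ) (hp : p ∈ S) : (p : ℝ) ∈ Set.Ioc X (B * X) := by
    obtain ⟨hXp, hpB⟩ := mem_Ioc.1 (Finset.mem_filter.1 hp).1
    exact ⟨(Nat.floor_lt (by linarith)).1 hXp, (Nat.le_floor_iff (by positivity)).1 hpB⟩
  calc ‖charProduct a y‖ ≤ Real.exp (-(u ^ 2 / 60 * #S)) :=
        hdecay S (fun p hp => (Finset.mem_filter.1 hp).2) hS_mem
    _ ≤ Real.exp (-(u ^ 2 / 60 * (σ / 2 * (2 / σ) ^ (κ / σ) * ‖y‖ ^ (1 / σ) *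
          Real.log ‖y‖ ^ (κ / σ - 1)))) := by
        gcongr
        exact hmain.trans ((div_le_iff₀' hlog).2 hcard)
    _ = _ := by ring_nf

end CubicTwists

theorem mainTheorem3 (σ : ℝ) (hσ : 1 / 2 < σ) :
    (∃ C₁ : ℝ, 0 < C₁ ∧ ∀ s : ℂ, s.re = σ →
      (∀ y : ℂ, Multipliable (CubicTwists.eulerFactor (CubicTwists.aLog s) y)) ∧
      ∀ᶠ y : ℂ in Bornology.cobounded ℂ,
        ‖CubicTwists.MtildeLog s y‖ ≤
          Real.exp (-C₁ * ‖y‖ ^ (1 / σ) * (Real.log ‖y‖)⁻¹)) ∧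
    (∃ C₂ : ℝ, 0 < C₂ ∧ ∀ s : ℂ, s.re = σ →
      (∀ y : ℂ, Multipliable (CubicTwists.eulerFactor (CubicTwists.aLogDeriv s) y)) ∧
      ∀ᶠ y : ℂ in Bornology.cobounded ℂ,
        ‖CubicTwists.MtildeLogDeriv s y‖ ≤
          Real.exp (-C₂ * ‖y‖ ^ (1 / σ) * Real.log ‖y‖ ^ (1 / σ - 1))) := by
  have hre (s : ℂ) (hs : s.re = σ) : 0 < s.re := by linarith
  have hlog (s : ℂ) (hs : s.re = σ) := hs ▸ CubicTwists.hasLeadingTerm_aLog (hre s hs)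
  have hlogDeriv (s : ℂ) (hs : s.re = σ) := hs ▸ CubicTwists.hasLeadingTerm_aLogDeriv (hre s hs)
  obtain ⟨C₁, hC₁, hdecay₁⟩ := CubicTwists.exists_norm_charProduct_le le_rfl hσ
  obtain ⟨C₂, hC₂, hdecay₂⟩ := CubicTwists.exists_norm_charProduct_le zero_le_one hσ
  simp only [zero_div, zero_sub, Real.rpow_neg_one] at hdecay₁
  exact ⟨⟨C₁, hC₁, fun s hs =>
      ⟨(hlog s hs).multipliable_eulerFactor hσ, hdecay₁ _ (hlog s hs)⟩⟩,
    ⟨C₂, hC₂, fun s hs =>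
      ⟨(hlogDeriv s hs).multipliable_eulerFactor hσ, hdecay₂ _ (hlogDeriv s hs)⟩⟩⟩
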